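/- Let $\mathscr A$ be a complex Banach $^*$-algebra (not necessarily unital, with a complete submultiplicative norm; the involution need not be continuous), let $\mathscr M\subseteq\mathscr A$ be a left ideal (a linear subspace with $xa\in\mathscr M$ for all $x\in\mathscr A$, $a\in\mathscr M$), and let $f:\mathscr M\to\mathbb C$ be a linear functional. Suppose there is $e\in\mathscr A$ with $ea=a$ for all $a\in\mathscr M$. A continuous linear functional $g:\mathscr A\to\mathbb C$ is called a representable positive extension of $f$ if $g|_{\mathscr M}=f$, $g(x^*x)\ge 0$ for all $x\in\mathscr A$, and there are a $^*$-representation $\pi$ of $\mathscr A$ by bounded operators on a Hilbert space $H$ and a vector $\zeta\in H$ with $g(x)=\langle\pi(x)\zeta,\zeta\rangle$ for all $x\in\mathscr A$. Then the following are equivalent (inequalities $s\le t$ between complex numbers mean that $t-s$ is real and nonnegative): (i) there is a representable positive extension $f_N$ of $f$ that is minimal, in the sense that $f_N(x^*x)\le g(x^*x)$ for all $x\in\mathscr A$ and every representable positive extension $g$ of $f$; (ii) there is a constant $C\ge 0$ with $|f(a)|^2\le C\,f(a^*a)$ for all $a\in\mathscr M$; (iii) there is a constant $K\ge 0$ with $\sup\{|f(x^*a)|^2: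 x\in\mathscr A,\ \|x\|\le 1\}\le K\,f(a^*a)$ for all $a\in\mathscr M$. Furthermore, suppose that one (hence each) of these conditions holds. Let $\bar{\mathscr A}'$ be the Banach space of continuous conjugate-linear functionals on $\mathscr A$. Then for each $a\in\mathscr M$ the functional $Aa: x\mapsto f(x^*a)$ belongs to $\bar{\mathscr A}'$, and the operator $A:\mathscr M\to\bar{\mathscr A}'$, $a\mapsto Aa$, has a Krein–von Neumann extension $A_N$, that is, a smallest element among the bounded linear operators $B:\mathscr A\to\bar{\mathscr A}'$ that extend $A$ and satisfy $(Bx)(x)\ge 0$ for all $x\in\mathscr A$, where $B\le B'$ means $(Bx)(x)\le(B'x)(x)$ for all $x\in\mathscr A$. Every $f_N$ as in (i) is given by $$f_N(x)=\overline{(A_Ne)(x)}\qquad(x\in\mathscr A).$$ -/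

import Mathlib

open scoped ComplexOrder

universe u

namespace KreinExt

/-! Inequalities between complex numbers are those of `ComplexOrder`: `z ≤ w` means that `w - z` is
a nonnegative real number; in particular `0 ≤ z` says that `z` is real and nonnegative. -/

section Operators

variable {E : Type u} [NormedAddCommGroup E] [NormedSpace ℂ E]

/-- The topological antidual of `E`: continuous conjugate-linear functionals, with the
operator norm. -/
abbrev Antidual (E : Type u) [NormedAddCommGroup E] [NormedSpace ℂ E] : Type u := E →L⋆[ℂ] ℂ

/-- An everywhere defined bounded operator `B : E → Antidual E` is positive if `⟨B x, x⟩ ≥ 0`. -/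
def IsPositiveOp (B : E →L[ℂ] Antidual E) : Prop :=
  ∀ x : E, 0 ≤ B x x

/-- `B` is a bounded positive extension of the (not everywhere defined) operator `T`. -/
def IsPositiveExtension (T : E →ₗ.[ℂ] Antidual E) (B : E →L[ℂ] Antidual E) : Prop :=
  IsPositiveOp B ∧ ∀ a : T.domain, B (a : E) = T a

/-- `B` is the Krein–von Neumann extension of `T`: the smallest bounded positive extension
of `T`, for the order `B ≤ B'` iff `⟨B x, x⟩ ≤ ⟨B' x, x⟩` for all `x`. -/
def IsKreinVonNeumannExtension (T : E →ₗ.[ℂ] Antidual E) (B : E →L[ℂ] Antidual E) : Prop :=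
  IsPositiveExtension T B ∧
    ∀ B' : E →L[ℂ] Antidual E, IsPositiveExtension T B' → ∀ x : E, B x x ≤ B' x x

end Operators

section Functionals

variable {𝒜 : Type u} [NonUnitalNormedRing 𝒜] [NormedSpace ℂ 𝒜] [StarRing 𝒜]

/-- A functional on `𝒜` is representable if it is of the form `x ↦ ⟨π(x) ζ, ζ⟩` for a
`*`-representation `π` of `𝒜` by bounded operators on a Hilbert space `H` and some `ζ` in `H`
(Mathlib's inner product is linear in its second argument). -/
def IsRepresentable (g : 𝒜 →L[ℂ] ℂ) : Prop :=
  ∃ (H : Type u) (_ : NormedAddCommGroup H) (_ : InnerProductSpace ℂ H) (_ : CompleteSpace H)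
    (π : 𝒜 →⋆ₙₐ[ℂ] (H →L[ℂ] H)) (ζ : H), ∀ x : 𝒜, g x = inner ℂ ζ (π x ζ)

/-- `g` is a continuous representable positive functional on `𝒜` that extends `f`. -/
structure IsRepresentableExtension {M : Submodule ℂ 𝒜} (f : M →ₗ[ℂ] ℂ) (g : 𝒜 →L[ℂ] ℂ) :
    Prop where
  positive : ∀ x : 𝒜, 0 ≤ g (star x * x)
  representable : IsRepresentable g
  extends_f : ∀ a : M, g (a : 𝒜) = f a

/-- `g` is a minimal representable positive extension of `f`. -/
def IsMinimalRepresentableExtension {M : Submodule ℂ 𝒜} (f : M →ₗ[ℂ] ℂ) (g : 𝒜 →L[ℂ] ℂ) :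
    Prop :=
  IsRepresentableExtension f g ∧
    ∀ g' : 𝒜 →L[ℂ] ℂ, IsRepresentableExtension f g' →
      ∀ x : 𝒜, g (star x * x) ≤ g' (star x * x)

variable {M : Submodule ℂ 𝒜}

/-- There is `C ≥ 0` with `|f(a)|² ≤ C f(a* a)` for all `a ∈ M`. -/
def CyclicBound (hM : ∀ x a : 𝒜, a ∈ M → x * a ∈ M) (f : M →ₗ[ℂ] ℂ) : Prop :=
  ∃ C : ℝ, 0 ≤ C ∧ ∀ a : M,
    ((‖f a‖ ^ 2 : ℝ) : ℂ) ≤ (C : ℂ) * f ⟨star (a : 𝒜) * a, hM _ _ a.2⟩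

/-- There is `K ≥ 0` with `sup {|f(x* a)|² : ‖x‖ ≤ 1} ≤ K f(a* a)` for all `a ∈ M`. -/
def SupBound (hM : ∀ x a : 𝒜, a ∈ M → x * a ∈ M) (f : M →ₗ[ℂ] ℂ) : Prop :=
  ∃ K : ℝ, 0 ≤ K ∧ ∀ a : M, ∀ x : 𝒜, ‖x‖ ≤ 1 →
    ((‖f ⟨star x * (a : 𝒜), hM _ _ a.2⟩‖ ^ 2 : ℝ) : ℂ) ≤
      (K : ℂ) * f ⟨star (a : 𝒜) * a, hM _ _ a.2⟩

variable [IsScalarTower ℂ 𝒜 𝒜] [SMulCommClass ℂ 𝒜 𝒜] [StarModule ℂ 𝒜]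

/-- The operator `A` from `𝒜` to its antidual, with domain `M`, given by `⟨A a, x⟩ = f(x* a)`,
where each `x ↦ f(x* a)` is supposed to be continuous. -/
def inducedOperator (hM : ∀ x a : 𝒜, a ∈ M → x * a ∈ M) (f : M →ₗ[ℂ] ℂ)
    (hc : ∀ a : M, Continuous fun x : 𝒜 => f ⟨star x * (a : 𝒜), hM _ _ a.2⟩) :
    𝒜 →ₗ.[ℂ] Antidual 𝒜 where
  domain := M
  toFun :=
    { toFun := fun a =>
        { toFun := fun x => f ⟨star x * (a : 𝒜), hM _ _ a.2⟩
          map_add' := fun x y => by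
            rw [← map_add]
            congr 1
            ext
            simp [add_mul]
          map_smul' := fun c x => by
            rw [← map_smul]
            congr 1
            ext
            simp [smul_mul_assoc]
          cont := hc a }
      map_add' := fun a b => by
        ext x
        change f _ = f _ + f _
        rw [← map_add]
        congr 1
        ext
        simp [mul_add]
      map_smul' := fun c a => by
        ext x
        change f _ = c • f _
        rw [← map_smul]
        congr 1
        ext
        simp [mul_smul_comm] }

end Functionals

end KreinExt

/-! The GNS construction is carried out on `M` itself. Under (ii) the form `f(a* b)` is positive and
`f` is bounded for its seminorm, so completing `M` gives a Hilbert space `H` and a Riesz vector `ζ`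
representing `f`. Left multiplications are bounded by Ford's square root lemma, which yields `π`
(`exists_gns`), and `π(a) ζ = ι(a)` on `M`. Then `⟨π(x) ζ, ζ⟩` serves as `f_N`, and `⟨A_N x, y⟩ =
⟨π(x) ζ, π(y) ζ⟩`. Both are minimal for one reason: `‖π(x) ζ‖` is computed by pairing with the dense
vectors `ι(b)`, which gives `f(x* b)`, and Cauchy–Schwarz bounds this for any positive form
extending the data (`norm_π_ζ_sq_le`). Minimal objects are unique by polarization, and `π(e) = 1`
turns `⟨π(x) ζ, ζ⟩` into the conjugate of `⟨A_N e, x⟩`. Boundedness of `A_N` and (iii) rest on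
automatic continuity of `π`, even for a discontinuous involution (`exists_norm_apply_le`). -/

open Filter Topology

namespace KreinExt

/-! ### Spectral radius and square roots with a discontinuous involution -/

section Spectral

variable {𝒜 : Type*} [NonUnitalNormedRing 𝒜] [CompleteSpace 𝒜] [NormedSpace ℂ 𝒜]
  [IsScalarTower ℂ 𝒜 𝒜] [SMulCommClass ℂ 𝒜 𝒜]

theorem norm_le_of_mem_quasispectrum {y : 𝒜} {k : ℂ} (hk : k ∈ quasispectrum ℂ y) :
    ‖k‖ ≤ ‖y‖ := by
  rw [Unitization.quasispectrum_eq_spectrum_inr' ℂ ℂ,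
    ← AlgEquiv.spectrum_eq (WithLp.unitizationAlgEquiv ℂ).symm (y : Unitization ℂ 𝒜)] at hk
  have h := spectrum.norm_le_norm_mul_of_mem hk
  have h1 : ‖(1 : WithLp 1 (Unitization ℂ 𝒜))‖ = 1 := by
    rw [WithLp.unitization_norm_def]
    change ‖(1 : Unitization ℂ 𝒜).fst‖ + ‖(1 : Unitization ℂ 𝒜).snd‖ = 1
    simp
  rw [h1, mul_one] at h
  exact h.trans_eq (WithLp.unitization_norm_inr y)

omit [CompleteSpace 𝒜] in
theorem quasispectrum_star [StarRing 𝒜] [StarModule ℂ 𝒜] (y : 𝒜) :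
    quasispectrum ℂ (star y) = star (quasispectrum ℂ y) := by
  simp only [Unitization.quasispectrum_eq_spectrum_inr' ℂ ℂ, Unitization.inr_star,
    spectrum.map_star]

variable [StarRing 𝒜] [StarModule ℂ 𝒜]

/-- The norm of `star y` is uncontrolled, but its spectrum is conjugate to that of `y`, so Gelfand's
formula still controls its powers. -/
theorem eventually_norm_pow_star_lt_one {y : 𝒜} (hy : ‖y‖ ≤ 1 / 2) :
    ∀ᶠ n : ℕ in atTop,
      ‖(WithLp.toLp 1 ((star y : 𝒜) : Unitization ℂ 𝒜)) ^ n‖ < 1 := by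
  set a : WithLp 1 (Unitization ℂ 𝒜) := WithLp.toLp 1 ((star y : 𝒜) : Unitization ℂ 𝒜) with ha
  have hr : spectralRadius ℂ a < 1 := by
    refine lt_of_le_of_lt (b := ((1 / 2 : NNReal) : ENNReal)) ?_ ?_
    · refine iSup₂_le fun k hk => ?_
      have hk' : k ∈ quasispectrum ℂ (star y) := by
        rw [Unitization.quasispectrum_eq_spectrum_inr' ℂ ℂ,
          ← AlgEquiv.spectrum_eq (WithLp.unitizationAlgEquiv ℂ).symm
            ((star y : 𝒜) : Unitization ℂ 𝒜)]
        exact hk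
      rw [quasispectrum_star] at hk'
      have h := (norm_le_of_mem_quasispectrum hk').trans hy
      rw [norm_star] at h
      norm_cast
    · norm_cast
      norm_num
  have hlim := spectrum.pow_norm_pow_one_div_tendsto_nhds_spectralRadius a
  filter_upwards [hlim.eventually_lt_const hr, eventually_gt_atTop 0] with n hn hn0
  by_contra! h
  refine absurd hn (not_lt.mpr ?_)
  exact ENNReal.one_le_ofReal.mpr (Real.one_le_rpow h (by positivity))

/-- **Ford's square root lemma**: with `1 - k` a square root of `1 - h`. The involution need not
be continuous. -/
theorem exists_selfAdjoint_two_smul_eq_add_mul_self {h : 𝒜} (hs : star h = h)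
    (hn : ‖h‖ ≤ 3 / 4) : ∃ k : 𝒜, star k = k ∧ (2 : ℂ) • k = h + k * k := by
  -- Since `(3/4 + 1/4) / 2 = 1/2`, the map `F` below preserves the ball. The bicommutant condition
  -- will make `k` commute with `star k`.
  set S : Set 𝒜 := {k | ‖k‖ ≤ 1 / 2 ∧ ∀ y, y * h = h * y → y * k = k * y} with hS
  have hSc : IsClosed S := by
    refine (isClosed_le continuous_norm continuous_const).inter ?_
    have : {k : 𝒜 | ∀ y, y * h = h * y → y * k = k * y} =
        ⋂ (y : 𝒜) (_ : y * h = h * y), {k | y * k = k * y} := by ext; simp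
    change IsClosed {k : 𝒜 | ∀ y, y * h = h * y → y * k = k * y}
    rw [this]
    exact isClosed_iInter fun y => isClosed_iInter fun _ => isClosed_eq (by fun_prop) (by fun_prop)
  set F : 𝒜 → 𝒜 := fun k => (1 / 2 : ℂ) • (h + k * k) with hF
  have hmaps : Set.MapsTo F S S := by
    rintro k ⟨hk, hc⟩
    refine ⟨?_, fun y hy => ?_⟩
    · have := norm_mul_le k k
      have h2 := norm_add_le h (k * k)
      have h3 : ‖F k‖ = 1 / 2 * ‖h + k * k‖ := by
        rw [hF, norm_smul]
        norm_num
      rw [h3]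
      nlinarith [norm_nonneg k]
    · simp only [hF, mul_smul_comm, smul_mul_assoc, mul_add, add_mul, hy]
      rw [← mul_assoc, hc y hy, mul_assoc, hc y hy, mul_assoc]
  have hcontr : ContractingWith (1 / 2) (hmaps.restrict F S S) := by
    refine ⟨by rw [← NNReal.coe_lt_coe]; norm_num, LipschitzWith.of_dist_le_mul ?_⟩
    rintro ⟨k, hk, -⟩ ⟨l, hl, -⟩
    simp only [Subtype.dist_eq, Set.MapsTo.val_restrict_apply, dist_eq_norm]
    have h1 : F k - F l = (1 / 2 : ℂ) • (k * (k - l) + (k - l) * l) := by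
      simp only [hF, ← smul_sub]
      congr 1
      simp only [mul_sub, sub_mul]
      abel
    have h2 := norm_add_le (k * (k - l)) ((k - l) * l)
    have h3 := norm_mul_le k (k - l)
    have h4 := norm_mul_le (k - l) l
    rw [h1, norm_smul]
    have h5 : ((1 / 2 : NNReal) : ℝ) = 1 / 2 := by norm_num
    rw [h5]
    have h6 : ‖(1 / 2 : ℂ)‖ = 1 / 2 := by norm_num
    rw [h6]
    nlinarith [norm_nonneg (k - l)]
  have h0 : (0 : 𝒜) ∈ S := ⟨by norm_num, by simp⟩
  obtain ⟨k, ⟨hk, hkc⟩, hfix, -⟩ :=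
    hcontr.exists_fixedPoint' hSc.isComplete hmaps h0 (edist_ne_top _ _)
  have hk2 : (2 : ℂ) • k = h + k * k := by
    have : F k = k := hfix
    conv_lhs => rw [← this]
    simp [hF, smul_smul]
  refine ⟨k, ?_, hk2⟩
  have hk2s : (2 : ℂ) • star k = h + star k * star k := by
    have := congrArg star hk2
    simpa [hs] using this
  have hcomm : k * star k = star k * k := by
    have hhk : h * k = k * h := hkc h rfl
    refine (hkc (star k) ?_).symm
    have := congrArg star hhk
    simpa [hs] using this
  -- As `j * star k = 2j - j * k` and `‖k‖ ≤ 1/2`, each right multiplication by `star k` expands the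
  -- norm by at least `3/2`; the powers of `star k` become small, so `j = 0`.
  set j := k - star k with hj
  have hjrel : (2 : ℂ) • j = j * k + j * star k := by
    rw [hj, smul_sub, hk2, hk2s, sub_mul, sub_mul, hcomm]
    abel
  have hjk : star k - k = -j := by rw [hj]; abel
  obtain ⟨n, hlt, hn0⟩ := ((eventually_norm_pow_star_lt_one hk).and (eventually_gt_atTop 0)).exists
  have hgrow : ∀ n : ℕ, ∃ v : 𝒜, (2 : ℂ) • v = v * k + v * star k ∧ ‖j‖ * (3 / 2) ^ n ≤ ‖v‖ ∧
      WithLp.toLp 1 (v : Unitization ℂ 𝒜) = WithLp.toLp 1 (j : Unitization ℂ 𝒜) *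
        WithLp.toLp 1 ((star k : 𝒜) : Unitization ℂ 𝒜) ^ n := by
    intro n
    induction n with
    | zero => exact ⟨j, hjrel, by simp, by simp⟩
    | succ n ih =>
      obtain ⟨v, hv, hvn, hvj⟩ := ih
      refine ⟨v * star k, ?_, ?_, ?_⟩
      · rw [← smul_mul_assoc, hv, add_mul, mul_assoc, hcomm, ← mul_assoc]
      · have h1 : v * star k = (2 : ℂ) • v - v * k := by rw [hv]; abel
        have h2 : ‖(2 : ℂ) • v‖ = 2 * ‖v‖ := by simp [norm_smul]
        have h3 := norm_sub_norm_le ((2 : ℂ) • v) (v * k)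
        have h4 := norm_mul_le v k
        rw [h1, pow_succ]
        nlinarith [norm_nonneg v]
      · rw [pow_succ, ← mul_assoc, ← hvj]
        apply WithLp.ofLp_injective
        rw [WithLp.unitization_mul]
        simp
  obtain ⟨v, -, hv, hvj⟩ := hgrow n
  have h1 : ‖v‖ ≤ ‖j‖ * 1 := by
    rw [← WithLp.unitization_norm_inr (𝕜 := ℂ) v, hvj,
      ← WithLp.unitization_norm_inr (𝕜 := ℂ) j]
    exact (norm_mul_le _ _).trans (mul_le_mul_of_nonneg_left hlt.le (norm_nonneg _))
  have h2 : (1 : ℝ) < (3 / 2) ^ n := one_lt_pow₀ (by norm_num) hn0.ne'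
  have h3 : ‖j‖ = 0 := by nlinarith [norm_nonneg j]
  exact (sub_eq_zero.mp (norm_eq_zero.mp h3)).symm

end Spectral

/-! ### Automatic continuity of `*`-homomorphisms -/

section Continuity

variable {𝒜 : Type*} [NonUnitalNormedRing 𝒜] [CompleteSpace 𝒜] [NormedSpace ℂ 𝒜]
  [IsScalarTower ℂ 𝒜 𝒜] [SMulCommClass ℂ 𝒜 𝒜] [StarRing 𝒜]
  {B : Type*} [CStarAlgebra B] (π : 𝒜 →⋆ₙₐ[ℂ] B)

theorem norm_apply_le_of_isSelfAdjoint {y : 𝒜} (hy : IsSelfAdjoint (π y)) : ‖π y‖ ≤ ‖y‖ := by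
  have h := hy.spectralRadius_eq_nnnorm
  have h2 : spectralRadius ℂ (π y) ≤ ‖y‖₊ := by
    refine iSup₂_le fun k hk => ?_
    have := norm_le_of_mem_quasispectrum
      (NonUnitalAlgHom.quasispectrum_apply_subset π y (spectrum_subset_quasispectrum ℂ _ hk))
    exact_mod_cast this
  rw [h] at h2
  exact_mod_cast h2

/-- Any such `y` may replace `star x`, whose norm need not be controlled by `‖x‖`. -/
theorem norm_apply_sq_le {x y : 𝒜} (h : π y = star (π x)) : ‖π x‖ ^ 2 ≤ ‖y‖ * ‖x‖ := by
  have h1 : π (y * x) = star (π x) * π x := by rw [map_mul, h]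
  have h2 := norm_apply_le_of_isSelfAdjoint π (y := y * x)
    (by rw [h1]; exact IsSelfAdjoint.star_mul_self _)
  rw [h1, CStarRing.norm_star_mul_self, ← sq] at h2
  exact h2.trans (norm_mul_le _ _)

/-- The pairs `(x, y)` such that `π y` is the adjoint of `π x`. -/
def adjointPairs : Submodule ℝ (𝒜 × 𝒜) where
  carrier := {p | π p.2 = star (π p.1)}
  add_mem' {p q} hp hq := by
    simp only [Set.mem_ofPred_eq, Prod.fst_add, Prod.snd_add, map_add, star_add] at *
    rw [hp, hq]
  zero_mem' := by simp
  smul_mem' c p hp := by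
    simp only [Set.mem_ofPred_eq, Prod.smul_fst, Prod.smul_snd] at *
    rw [← Complex.coe_smul, ← Complex.coe_smul, map_smul, map_smul, star_smul, hp]
    simp

/-- If `(xₙ, yₙ) → (x, y)`, then `(xₙ - x, yₙ - star x)` is again an adjoint pair, so `‖π(xₙ - x)‖²`
is at most a bounded factor times `‖xₙ - x‖`; likewise for `yₙ`. -/
theorem isClosed_adjointPairs : IsClosed (adjointPairs π : Set (𝒜 × 𝒜)) := by
  refine IsSeqClosed.isClosed fun u p hu hp => ?_
  obtain ⟨x, y⟩ := p
  have hx : Tendsto (fun n => (u n).1 - x) atTop (𝓝 0) := by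
    have := ((continuous_fst.tendsto _).comp hp).sub_const x
    simpa using this
  have hy : Tendsto (fun n => (u n).2 - y) atTop (𝓝 0) := by
    have := ((continuous_snd.tendsto _).comp hp).sub_const y
    simpa using this
  have hu' : ∀ n, π (u n).2 = star (π (u n).1) := hu
  have h1 : Tendsto (fun n => ‖π ((u n).1 - x)‖ ^ 2) atTop (𝓝 0) := by
    refine squeeze_zero (fun n => by positivity)
      (fun n => norm_apply_sq_le π (y := (u n).2 - star x) (by simp [hu', map_star])) ?_
    have h2 : Tendsto (fun n => (u n).2 - star x) atTop (𝓝 (y - star x)) :=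
      ((continuous_snd.tendsto _).comp hp).sub_const _
    simpa using h2.norm.mul hx.norm
  have h2 : Tendsto (fun n => ‖π ((u n).2 - y)‖ ^ 2) atTop (𝓝 0) := by
    refine squeeze_zero (fun n => by positivity)
      (fun n => norm_apply_sq_le π (y := (u n).1 - star y) (by simp [hu', map_star])) ?_
    have h2 : Tendsto (fun n => (u n).1 - star y) atTop (𝓝 (x - star y)) :=
      ((continuous_fst.tendsto _).comp hp).sub_const _
    simpa using h2.norm.mul hy.norm
  have key : ∀ {v : ℕ → B}, Tendsto (fun n => ‖v n‖ ^ 2) atTop (𝓝 0) →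
      Tendsto v atTop (𝓝 0) := fun {v} hv => by
    rw [tendsto_zero_iff_norm_tendsto_zero]
    have := hv.sqrt
    simpa using this
  have h3 := ((key h1).star).sub (key h2)
  have h4 : (fun n => star (π ((u n).1 - x)) - π ((u n).2 - y)) =
      fun _ => π y - star (π x) := by
    funext n
    simp only [map_sub, star_sub, hu']
    abel
  rw [h4] at h3
  have h5 := tendsto_nhds_unique h3 tendsto_const_nhds
  simp only [star_zero, sub_zero] at h5
  exact (sub_eq_zero.mp h5.symm)

/-- Automatic continuity of `*`-homomorphisms from a Banach `*`-algebra, whose involution may be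
discontinuous, to a C⋆-algebra. -/
theorem exists_norm_apply_le : ∃ c : ℝ, 0 ≤ c ∧ ∀ x : 𝒜, ‖π x‖ ≤ c * ‖x‖ := by
  have : CompleteSpace (adjointPairs π) := (isClosed_adjointPairs π).completeSpace_coe
  let T : adjointPairs π →L[ℝ] 𝒜 :=
    (ContinuousLinearMap.fst ℝ 𝒜 𝒜).comp (adjointPairs π).subtypeL
  -- The open mapping theorem then provides a partner `y` of `x` with `‖y‖ ≤ C ‖x‖`.
  have hT : Function.Surjective T := fun x =>
    ⟨⟨(x, star x), map_star π x⟩, rfl⟩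
  obtain ⟨C, hC, h⟩ := T.exists_preimage_norm_le hT
  refine ⟨√C, by positivity, fun x => ?_⟩
  obtain ⟨⟨⟨x', y⟩, hp⟩, hpx, hle⟩ := h x
  obtain rfl : x' = x := hpx
  have h1 := norm_apply_sq_le π hp
  have h2 : ‖y‖ ≤ C * ‖x'‖ := (norm_snd_le (x', y)).trans hle
  rw [← abs_of_nonneg (norm_nonneg (π x')), ← Real.sqrt_sq (norm_nonneg x'),
    ← Real.sqrt_mul hC.le]
  refine Real.abs_le_sqrt (h1.trans ?_)
  dsimp only
  nlinarith [norm_nonneg x']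

end Continuity

end KreinExt

namespace KreinExt

/-! ### Positive sesquilinear forms -/

section SesquilinearForms

variable {V : Type u} [AddCommGroup V] [Module ℂ V]

theorem sesqForm_ext {S T : V →ₗ⋆[ℂ] V →ₗ[ℂ] ℂ} (h : ∀ x, S x x = T x x) : S = T := by
  ext x y
  have h1 := h (x + y)
  have h2 := h (x + Complex.I • y)
  simp only [map_add, map_smul, LinearMap.map_smulₛₗ, LinearMap.add_apply, LinearMap.smul_apply,
    smul_eq_mul, Complex.conj_I, h x, h y] at h1 h2
  linear_combination (1 / 2 : ℂ) * h1 - Complex.I / 2 * h2 +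
    (S x y / 2 - T x y / 2 + T y x / 2 - S y x / 2) * Complex.I_mul_I

theorem conj_sesqForm {S : V →ₗ⋆[ℂ] V →ₗ[ℂ] ℂ} (hS : ∀ x, 0 ≤ S x x) (x y : V) :
    starRingEnd ℂ (S y x) = S x y := by
  have him : ∀ x, (S x x).im = 0 := fun x => ((Complex.le_def.mp (hS x)).2).symm
  have h1 := him (x + y)
  have h2 := him (x + Complex.I • y)
  simp [him x, him y] at h1 h2
  apply Complex.ext
  · simp
    linarith
  · simp
    linarith

/-- The Hilbert space obtained from a positive sesquilinear form. -/
theorem exists_hilbertSpace {S : V →ₗ⋆[ℂ] V →ₗ[ℂ] ℂ} (hS : ∀ x, 0 ≤ S x x) :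
    ∃ (H : Type u) (_ : NormedAddCommGroup H) (_ : InnerProductSpace ℂ H) (_ : CompleteSpace H)
      (ι : V →ₗ[ℂ] H), DenseRange ι ∧ ∀ a b, inner ℂ (ι a) (ι b) = S a b := by
  let c : PreInnerProductSpace.Core ℂ V :=
    { inner := fun x y => S x y
      conj_inner_symm := conj_sesqForm hS
      re_inner_nonneg := fun x => (Complex.le_def.mp (hS x)).1
      add_left := fun x y z => by simp
      smul_left := fun x y r => by simp }
  let : SeminormedAddCommGroup V := InnerProductSpace.Core.toSeminormedAddCommGroup (c := c)
  let : InnerProductSpace ℂ V := InnerProductSpace.ofCore c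
  refine ⟨UniformSpace.Completion V, inferInstance, inferInstance, inferInstance,
    (UniformSpace.Completion.toComplₗᵢ (𝕜 := ℂ) (E := V)).toLinearMap, ?_, fun a b => ?_⟩
  · exact UniformSpace.Completion.denseRange_coe
  · exact UniformSpace.Completion.inner_coe a b

theorem norm_sesqForm_sq_le {S : V →ₗ⋆[ℂ] V →ₗ[ℂ] ℂ} (hS : ∀ x, 0 ≤ S x x) (x y : V) :
    ‖S x y‖ ^ 2 ≤ (S x x).re * (S y y).re := by
  obtain ⟨H, _, _, _, ι, -, hι⟩ := exists_hilbertSpace hS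
  have h (z : V) : ‖ι z‖ ^ 2 = (S z z).re := by
    rw [← hι, inner_self_eq_norm_sq_to_K]
    norm_cast
  rw [← hι x y, ← h, ← h, ← mul_pow]
  exact pow_le_pow_left₀ (norm_nonneg _) (norm_inner_le_norm _ _) 2

end SesquilinearForms

/-! ### GNS construction on a left ideal -/

section GNS

variable {𝒜 : Type u} [NonUnitalNormedRing 𝒜] [NormedSpace ℂ 𝒜]
  [IsScalarTower ℂ 𝒜 𝒜] [SMulCommClass ℂ 𝒜 𝒜] [StarRing 𝒜] [StarModule ℂ 𝒜]
  {M : Submodule ℂ 𝒜} (hM : ∀ x a : 𝒜, a ∈ M → x * a ∈ M) (f : M →ₗ[ℂ] ℂ)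

/-- The sesquilinear form `(a, b) ↦ f(a* b)` on a left ideal. -/
def idealForm : M →ₗ⋆[ℂ] M →ₗ[ℂ] ℂ :=
  LinearMap.mk₂'ₛₗ (starRingEnd ℂ) (RingHom.id ℂ)
    (fun a b => f ⟨star (a : 𝒜) * b, hM _ _ b.2⟩)
    (fun a b c => by
      rw [← map_add]
      congr 1
      ext
      simp [add_mul])
    (fun r a b => by
      rw [← map_smul]
      congr 1
      ext
      simp [smul_mul_assoc])
    (fun a b c => by
      rw [← map_add]
      congr 1
      ext
      simp [mul_add])
    (fun r a b => by
      rw [RingHom.id_apply, ← map_smul]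
      congr 1
      ext
      simp [mul_smul_comm])

omit [IsScalarTower ℂ 𝒜 𝒜] [StarModule ℂ 𝒜] in
/-- Left multiplication on a left ideal. -/
def idealMul (x : 𝒜) : M →ₗ[ℂ] M where
  toFun a := ⟨x * a, hM _ _ a.2⟩
  map_add' a b := by
    ext
    simp [mul_add]
  map_smul' r a := by
    ext
    simp [mul_smul_comm]

variable {f}

theorem idealForm_self_nonneg (hf : CyclicBound hM f) (a : M) : 0 ≤ idealForm hM f a a := by
  obtain ⟨C, hC, h⟩ := hf
  change 0 ≤ f ⟨star (a : 𝒜) * a, hM _ _ a.2⟩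
  -- For `C = 0` the bound cannot be divided by `C`, but it forces `f = 0`.
  rcases hC.eq_or_lt with rfl | hC
  · have h0 : ∀ b, f b = 0 := fun b => by
      have hb := h b
      simp only [Complex.ofReal_zero, zero_mul, Complex.le_def, Complex.ofReal_re,
        Complex.zero_re] at hb
      exact norm_eq_zero.mp (pow_eq_zero_iff two_ne_zero |>.mp (le_antisymm hb.1 (by positivity)))
    rw [h0]
  · have h1 : (0 : ℂ) ≤ (C : ℂ) * f ⟨star (a : 𝒜) * a, hM _ _ a.2⟩ :=
      le_trans (Complex.zero_le_real.mpr (sq_nonneg _)) (h a)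
    rw [Complex.le_def, Complex.re_ofReal_mul, Complex.im_ofReal_mul] at h1
    exact Complex.le_def.mpr ⟨nonneg_of_mul_nonneg_right h1.1 hC,
      (mul_eq_zero.mp h1.2.symm |>.resolve_left hC.ne').symm⟩

/-- A GNS representation for the functional `f` on the left ideal `M`: a `*`-representation `π` on
`H`, a dense map `ι` from `M` that carries `f(a* b)` to the inner product and intertwines `π` with
left multiplication, and a vector `ζ` that represents `f`. -/
structure IdealGNS (f : M →ₗ[ℂ] ℂ) (H : Type*) [NormedAddCommGroup H] [InnerProductSpace ℂ H]
    [CompleteSpace H] where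
  ι : M →ₗ[ℂ] H
  π : 𝒜 →⋆ₙₐ[ℂ] (H →L[ℂ] H)
  ζ : H
  dense : DenseRange ι
  inner_ι : ∀ a b, inner ℂ (ι a) (ι b) = idealForm hM f a b
  π_ι : ∀ x a, π x (ι a) = ι (idealMul hM x a)
  inner_ζ : ∀ a, inner ℂ ζ (ι a) = f a

variable [CompleteSpace 𝒜]

/-- Formally `1 - h = (1 - k)²` with `k` self-adjoint, so the difference of the two sides is the
form at `a - k a`, which lies in `M`. -/
theorem idealForm_mul_le (hS : ∀ a, 0 ≤ idealForm hM f a a) {h : 𝒜} (hs : star h = h)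
    (hn : ‖h‖ ≤ 3 / 4) (a : M) :
    idealForm hM f a (idealMul hM h a) ≤ idealForm hM f a a := by
  obtain ⟨k, hk, hk2⟩ := exists_selfAdjoint_two_smul_eq_add_mul_self hs hn
  have h0 := hS (a - idealMul hM k a)
  have h1 : idealForm hM f (a - idealMul hM k a) (a - idealMul hM k a) =
      idealForm hM f a a - idealForm hM f a (idealMul hM h a) := by
    simp only [idealForm, LinearMap.mk₂'ₛₗ_apply, ← map_sub]
    congr 1
    ext
    have hh : h = k + k - k * k := by rw [← two_smul ℂ, hk2]; abel
    simp only [idealMul, LinearMap.coe_mk, AddHom.coe_mk, AddSubgroupClass.coe_sub, star_sub,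
      star_mul, hk, hh]
    noncomm_ring
  rw [h1] at h0
  exact sub_nonneg.mp h0

theorem exists_bound_idealMul (hS : ∀ a, 0 ≤ idealForm hM f a a) (x : 𝒜) :
    ∃ c : ℝ, 0 ≤ c ∧ ∀ a : M, (idealForm hM f (idealMul hM x a) (idealMul hM x a)).re ≤
      c * (idealForm hM f a a).re := by
  -- Scales `star x * x` into the range of the square root lemma.
  set t : ℝ := 3 / 4 / (‖star x * x‖ + 1) with ht
  have ht0 : 0 < t := by positivity
  refine ⟨t⁻¹, by positivity, fun a => ?_⟩
  have h1 := idealForm_mul_le hM hS (h := (t : ℂ) • (star x * x)) (by simp)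
    (by
      rw [norm_smul, Complex.norm_real, Real.norm_of_nonneg ht0.le, ht, div_mul_eq_mul_div,
        div_le_iff₀ (by positivity)]
      nlinarith [norm_nonneg (star x * x)]) a
  have h2 : idealForm hM f a (idealMul hM ((t : ℂ) • (star x * x)) a) =
      (t : ℂ) * idealForm hM f (idealMul hM x a) (idealMul hM x a) := by
    change _ = (t : ℂ) • idealForm hM f (idealMul hM x a) (idealMul hM x a)
    rw [← map_smul]
    simp only [idealForm, LinearMap.mk₂'ₛₗ_apply]
    congr 1
    ext
    simp [idealMul, mul_assoc, smul_mul_assoc, mul_smul_comm, -Complex.coe_smul]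
  rw [h2] at h1
  have h3 := (Complex.le_def.mp h1).1
  rw [Complex.re_ofReal_mul] at h3
  rwa [inv_mul_eq_div, le_div_iff₀ ht0, mul_comm]

/-- The GNS construction for a functional on a left ideal of a Banach `*`-algebra. -/
theorem exists_gns (hf : CyclicBound hM f) :
    ∃ (H : Type u) (_ : NormedAddCommGroup H) (_ : InnerProductSpace ℂ H) (_ : CompleteSpace H),
      Nonempty (IdealGNS hM f H) := by
  have hS := idealForm_self_nonneg hM hf
  obtain ⟨H, _, _, _, ι, hd, hι⟩ := exists_hilbertSpace hS
  have hnorm (a : M) : ‖ι a‖ ^ 2 = (idealForm hM f a a).re := by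
    rw [← hι, inner_self_eq_norm_sq_to_K]
    norm_cast
  have hb (x : 𝒜) : ∃ c, ∀ a, ‖(ι ∘ₗ idealMul hM x) a‖ ≤ c * ‖ι a‖ := by
    obtain ⟨c, hc, h⟩ := exists_bound_idealMul hM hS x
    refine ⟨√c, fun a => ?_⟩
    rw [← Real.sqrt_sq (norm_nonneg (ι a)), ← Real.sqrt_mul hc, hnorm]
    refine Real.le_sqrt_of_sq_le ?_
    rw [LinearMap.comp_apply, hnorm]
    exact h a
  let P (x : 𝒜) : H →L[ℂ] H := (ι ∘ₗ idealMul hM x).extendOfNorm ι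
  have hP (x : 𝒜) (a : M) : P x (ι a) = ι (idealMul hM x a) :=
    LinearMap.extendOfNorm_eq hd (hb x) a
  have hext {T U : H →L[ℂ] H} (h : ∀ a, T (ι a) = U (ι a)) : T = U :=
    DFunLike.coe_injective (hd.equalizer T.continuous U.continuous (funext h))
  have hsmul (r : ℂ) (x : 𝒜) : P (r • x) = r • P x := hext fun a => by
    rw [smul_apply, hP, hP, ← map_smul]
    congr 1
    ext
    simp [idealMul, smul_mul_assoc]
  let π : 𝒜 →⋆ₙₐ[ℂ] (H →L[ℂ] H) :=
    { toFun := P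
      map_smul' := hsmul
      map_zero' := by simpa using hsmul 0 0
      map_add' := fun x y => hext fun a => by
        rw [add_apply, hP, hP, hP, ← map_add]
        congr 1
        ext
        simp [idealMul, add_mul]
      map_mul' := fun x y => hext fun a => by
        rw [mul_apply_eq_comp, hP, hP, hP]
        congr 1
        ext
        simp [idealMul, mul_assoc]
      map_star' := fun x => by
        refine (ContinuousLinearMap.eq_adjoint_iff _ _).mpr fun u v => ?_
        refine hd.induction_on₂ (p := fun u v => inner ℂ (P (star x) u) v = inner ℂ u (P x v))
          (isClosed_eq (by fun_prop) (by fun_prop)) (fun a b => ?_) u v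
        rw [hP, hP, hι, hι]
        simp only [idealForm, LinearMap.mk₂'ₛₗ_apply]
        congr 1
        ext
        simp [idealMul, mul_assoc] }
  have hfb : ∃ c, ∀ a, ‖f a‖ ≤ c * ‖ι a‖ := by
    obtain ⟨C, hC, h⟩ := hf
    refine ⟨√C, fun a => ?_⟩
    rw [← Real.sqrt_sq (norm_nonneg (ι a)), ← Real.sqrt_mul hC, hnorm]
    refine Real.le_sqrt_of_sq_le ?_
    have := (Complex.le_def.mp (h a)).1
    rwa [Complex.re_ofReal_mul, Complex.ofReal_re] at this
  have hζ (a : M) :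
      inner ℂ ((InnerProductSpace.toDual ℂ H).symm (f.extendOfNorm ι)) (ι a) = f a := by
    rw [InnerProductSpace.toDual_symm_apply, LinearMap.extendOfNorm_eq hd hfb]
  exact ⟨H, _, _, ‹_›, ⟨⟨ι, π, _, hd, hι, hP, hζ⟩⟩⟩

end GNS

end KreinExt

namespace KreinExt

/-! ### Vector functionals of representations -/

section Representations

theorem norm_sq_le_of_dense {V H : Type*} [NormedAddCommGroup H] [InnerProductSpace ℂ H]
    {ι : V → H} (hd : DenseRange ι) {v : H} {t : ℝ} (ht : 0 ≤ t)
    (h : ∀ b, ‖inner ℂ v (ι b)‖ ^ 2 ≤ t * ‖ι b‖ ^ 2) : ‖v‖ ^ 2 ≤ t := by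
  have h1 : ‖inner ℂ v v‖ ^ 2 ≤ t * ‖v‖ ^ 2 :=
    hd.induction_on (p := fun w => ‖inner ℂ v w‖ ^ 2 ≤ t * ‖w‖ ^ 2) v
      (isClosed_le (by fun_prop) (by fun_prop)) h
  rw [inner_self_eq_norm_sq_to_K, norm_pow, RCLike.norm_ofReal, abs_norm] at h1
  rcases eq_or_ne v 0 with rfl | hv
  · simpa using ht
  · have : 0 < ‖v‖ ^ 2 := by positivity
    nlinarith

theorem inner_self_eq_norm_sq_complex {H : Type*} [NormedAddCommGroup H] [InnerProductSpace ℂ H]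
    (v : H) : inner ℂ v v = ((‖v‖ ^ 2 : ℝ) : ℂ) := by
  rw [inner_self_eq_norm_sq_to_K]
  norm_cast

variable {𝒜 : Type*} [NonUnitalNormedRing 𝒜] [NormedSpace ℂ 𝒜] [StarRing 𝒜]
  {H : Type*} [NormedAddCommGroup H] [InnerProductSpace ℂ H] [CompleteSpace H]
  (π : 𝒜 →⋆ₙₐ[ℂ] (H →L[ℂ] H))

theorem inner_rep_star_mul (x y : 𝒜) (u v : H) :
    inner ℂ u (π (star x * y) v) = inner ℂ (π x u) (π y v) := by
  rw [map_mul, map_star, mul_apply_eq_comp, ContinuousLinearMap.star_eq_adjoint,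
    ContinuousLinearMap.adjoint_inner_right]

theorem inner_rep_star (x : 𝒜) (u v : H) :
    inner ℂ u (π (star x) v) = inner ℂ (π x u) v := by
  rw [map_star, ContinuousLinearMap.star_eq_adjoint, ContinuousLinearMap.adjoint_inner_right]

end Representations

section Functionals

variable {𝒜 : Type u} [NonUnitalNormedRing 𝒜] [NormedSpace ℂ 𝒜]
  [IsScalarTower ℂ 𝒜 𝒜] [SMulCommClass ℂ 𝒜 𝒜] [StarRing 𝒜] [StarModule ℂ 𝒜]

/-- The sesquilinear form `(x, y) ↦ g(x* y)`. -/
noncomputable def functionalForm (g : 𝒜 →L[ℂ] ℂ) : 𝒜 →ₗ⋆[ℂ] 𝒜 →ₗ[ℂ] ℂ :=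
  LinearMap.mk₂'ₛₗ (starRingEnd ℂ) (RingHom.id ℂ) (fun x y => g (star x * y))
    (by simp [add_mul]) (by simp [smul_mul_assoc]) (by simp [mul_add])
    (by simp [mul_smul_comm])

omit [StarRing 𝒜] [StarModule ℂ 𝒜] [IsScalarTower ℂ 𝒜 𝒜] [SMulCommClass ℂ 𝒜 𝒜] in
/-- The sesquilinear form `(x, y) ↦ ⟨B y, x⟩`. -/
noncomputable def operatorForm (B : 𝒜 →L[ℂ] Antidual 𝒜) : 𝒜 →ₗ⋆[ℂ] 𝒜 →ₗ[ℂ] ℂ :=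
  LinearMap.mk₂'ₛₗ (starRingEnd ℂ) (RingHom.id ℂ) (fun x y => B y x)
    (by simp) (by simp) (by simp) (by simp)

omit [IsScalarTower ℂ 𝒜 𝒜] [SMulCommClass ℂ 𝒜 𝒜] [StarModule ℂ 𝒜] in
/-- If `e` is a left unit modulo the kernel of the form `(x, y) ↦ g(x* y)` of a representable
functional `g`, then `g(e x) = g(x)`. -/
theorem apply_left_unit_of_isRepresentable {g : 𝒜 →L[ℂ] ℂ} (hg : IsRepresentable g) {e : 𝒜}
    (he : ∀ y, g (star (e * y - y) * (e * y - y)) = 0) (x : 𝒜) : g (e * x) = g x := by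
  obtain ⟨H, _, _, _, π, ζ, h⟩ := hg
  have h0 : π (e * x - x) ζ = 0 := by
    have := he x
    rwa [h, inner_rep_star_mul, inner_self_eq_zero] at this
  rw [map_sub, sub_apply, sub_eq_zero] at h0
  rw [h, h, h0]

end Functionals

/-! ### Minimality and uniqueness -/

namespace IdealGNS

variable {𝒜 : Type u} [NonUnitalNormedRing 𝒜] [CompleteSpace 𝒜] [NormedSpace ℂ 𝒜]
  [IsScalarTower ℂ 𝒜 𝒜] [SMulCommClass ℂ 𝒜 𝒜] [StarRing 𝒜] [StarModule ℂ 𝒜]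
  {M : Submodule ℂ 𝒜} {hM : ∀ x a : 𝒜, a ∈ M → x * a ∈ M} {f : M →ₗ[ℂ] ℂ}
  {H : Type u} [NormedAddCommGroup H] [InnerProductSpace ℂ H] [CompleteSpace H]
  (D : IdealGNS hM f H)

omit [CompleteSpace 𝒜] in
theorem inner_π_ζ_ι (x : 𝒜) (a : M) :
    inner ℂ (D.π x D.ζ) (D.ι a) = f ⟨star x * (a : 𝒜), hM _ _ a.2⟩ := by
  rw [← inner_rep_star, D.π_ι, D.inner_ζ]
  rfl

omit [CompleteSpace 𝒜] in
-- Both vectors pair with `ι b` to `f(a* b)`, and the `ι b` are dense.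
theorem π_coe_ζ (a : M) : D.π a D.ζ = D.ι a :=
  D.dense.eq_of_inner_left ℂ fun b => by
    rw [D.inner_π_ζ_ι, D.inner_ι]
    rfl

omit [CompleteSpace 𝒜] in
theorem norm_ι_sq (a : M) :
    ((‖D.ι a‖ ^ 2 : ℝ) : ℂ) = f ⟨star (a : 𝒜) * a, hM _ _ a.2⟩ := by
  rw [← inner_self_eq_norm_sq_complex, D.inner_ι]
  rfl

/-- The map `x ↦ π(x) ζ`. -/
noncomputable def orbit : 𝒜 →L[ℂ] H :=
  LinearMap.mkContinuousOfExistsBound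
    { toFun := fun x => D.π x D.ζ
      map_add' := by simp
      map_smul' := by simp }
    (by
      obtain ⟨c, -, hc⟩ := exists_norm_apply_le D.π
      refine ⟨c * ‖D.ζ‖, fun x => ?_⟩
      refine ((D.π x).le_opNorm D.ζ).trans ?_
      rw [mul_right_comm]
      exact mul_le_mul_of_nonneg_right (hc x) (norm_nonneg _))

@[simp]
theorem orbit_apply (x : 𝒜) : D.orbit x = D.π x D.ζ := rfl

include D in
theorem supBound : SupBound hM f := by
  refine ⟨‖D.orbit‖ ^ 2, by positivity, fun a x hx => ?_⟩
  rw [← D.norm_ι_sq, ← D.inner_π_ζ_ι, ← Complex.ofReal_mul, Complex.real_le_real, ← mul_pow]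
  refine pow_le_pow_left₀ (norm_nonneg _) ((norm_inner_le_norm _ _).trans ?_) 2
  exact mul_le_mul_of_nonneg_right (D.orbit.unit_le_opNorm x hx) (norm_nonneg _)

include D in
theorem continuous_apply_star_mul (a : M) :
    Continuous fun x : 𝒜 => f ⟨star x * (a : 𝒜), hM _ _ a.2⟩ := by
  simp_rw [← D.inner_π_ζ_ι, ← D.orbit_apply]
  fun_prop

/-- The functional `x ↦ ⟨π(x) ζ, ζ⟩`. -/
noncomputable def functional : 𝒜 →L[ℂ] ℂ := (innerSL ℂ D.ζ).comp D.orbit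

theorem functional_apply (x : 𝒜) : D.functional x = inner ℂ D.ζ (D.π x D.ζ) := rfl

theorem functional_star_mul (x y : 𝒜) :
    D.functional (star x * y) = inner ℂ (D.π x D.ζ) (D.π y D.ζ) := by
  rw [functional_apply, inner_rep_star_mul]

theorem functional_star_mul_self (x : 𝒜) :
    D.functional (star x * x) = ((‖D.π x D.ζ‖ ^ 2 : ℝ) : ℂ) := by
  rw [functional_star_mul, inner_self_eq_norm_sq_complex]

omit [CompleteSpace 𝒜] in
/-- `‖π(x) ζ‖²` is at most `S(x, x)` for every positive sesquilinear form that extends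
`(x, a) ↦ f(x* a)`. -/
theorem norm_π_ζ_sq_le {S : 𝒜 →ₗ⋆[ℂ] 𝒜 →ₗ[ℂ] ℂ} (hS : ∀ x, 0 ≤ S x x)
    (hSf : ∀ (x : 𝒜) (a : M), S x a = f ⟨star x * (a : 𝒜), hM _ _ a.2⟩) (x : 𝒜) :
    ((‖D.π x D.ζ‖ ^ 2 : ℝ) : ℂ) ≤ S x x := by
  have hx := Complex.le_def.mp (hS x)
  rw [Complex.le_def, Complex.ofReal_re, Complex.ofReal_im]
  refine ⟨norm_sq_le_of_dense D.dense hx.1 fun b => ?_, hx.2⟩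
  have h := norm_sesqForm_sq_le hS x b
  rw [hSf, hSf, ← D.inner_π_ζ_ι] at h
  rwa [← D.norm_ι_sq, Complex.ofReal_re] at h

theorem isMinimalRepresentableExtension_functional :
    IsMinimalRepresentableExtension f D.functional := by
  refine ⟨⟨fun x => ?_, ⟨H, _, _, ‹_›, D.π, D.ζ, D.functional_apply⟩, fun a => ?_⟩,
    fun g hg x => ?_⟩
  · rw [functional_star_mul_self]
    exact Complex.zero_le_real.mpr (by positivity)
  · rw [functional_apply, π_coe_ζ, inner_ζ]
  · rw [functional_star_mul_self]
    exact D.norm_π_ζ_sq_le (S := functionalForm g) hg.positive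
      (fun x a => hg.extends_f ⟨star x * (a : 𝒜), hM _ _ a.2⟩) x

/-- The operator with `⟨A x, y⟩ = ⟨π(x) ζ, π(y) ζ⟩`. -/
noncomputable def operator : 𝒜 →L[ℂ] Antidual 𝒜 :=
  LinearMap.mkContinuous₂
    (LinearMap.mk₂'ₛₗ (RingHom.id ℂ) (starRingEnd ℂ)
      (fun x y => inner ℂ (D.orbit y) (D.orbit x))
      (by simp) (by simp) (by simp) (by simp [mul_comm]))
    (‖D.orbit‖ * ‖D.orbit‖) fun x y => by
      refine (norm_inner_le_norm _ _).trans ?_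
      have := mul_le_mul (D.orbit.le_opNorm y) (D.orbit.le_opNorm x) (norm_nonneg _)
        (by positivity)
      linarith

theorem operator_apply (x y : 𝒜) :
    D.operator x y = inner ℂ (D.π y D.ζ) (D.π x D.ζ) := rfl

theorem isKreinVonNeumannExtension_operator
    (hc : ∀ a : M, Continuous fun x : 𝒜 => f ⟨star x * (a : 𝒜), hM _ _ a.2⟩) :
    IsKreinVonNeumannExtension (inducedOperator hM f hc) D.operator := by
  refine ⟨⟨fun x => ?_, fun a => ?_⟩, fun B hB x => ?_⟩
  · rw [operator_apply, inner_self_eq_norm_sq_complex]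
    exact Complex.zero_le_real.mpr (by positivity)
  · change M at a
    ext x
    rw [operator_apply, π_coe_ζ, inner_π_ζ_ι]
    rfl
  · rw [operator_apply, inner_self_eq_norm_sq_complex]
    refine D.norm_π_ζ_sq_le (S := operatorForm B) hB.1 (fun x a => ?_) x
    change B a x = _
    rw [hB.2 (a : M)]
    rfl

omit [CompleteSpace 𝒜] in
theorem π_left_unit {e : 𝒜} (he : ∀ a ∈ M, e * a = a) (v : H) : D.π e v = v := by
  refine D.dense.induction_on (p := fun v => D.π e v = v) v
    (isClosed_eq (by fun_prop) (by fun_prop)) fun a => ?_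
  rw [D.π_ι]
  congr 1
  ext
  exact he a a.2

/-- Minimality and polarization fix `g` only on products `x* y`; representability gives `g(e x) =
g(x)`, and `e x` is such a product. -/
theorem eq_functional {e : 𝒜} (he : ∀ a ∈ M, e * a = a) {g : 𝒜 →L[ℂ] ℂ}
    (hg : IsMinimalRepresentableExtension f g) : g = D.functional := by
  have hD := D.isMinimalRepresentableExtension_functional
  have h1 : functionalForm g = functionalForm D.functional :=
    sesqForm_ext fun x => le_antisymm (hg.2 _ hD.1 x) (hD.2 _ hg.1 x)
  have h2 (x y : 𝒜) : g (star x * y) = D.functional (star x * y) :=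
    LinearMap.congr_fun₂ h1 x y
  have hπ (y : 𝒜) : D.π (e * y - y) D.ζ = 0 := by
    rw [map_sub, sub_apply, map_mul, mul_apply_eq_comp, D.π_left_unit he,
      sub_self]
  ext x
  rw [← apply_left_unit_of_isRepresentable hg.1.representable (e := e) (fun y => by
      rw [h2, functional_star_mul_self, hπ]; simp),
    ← apply_left_unit_of_isRepresentable hD.1.representable (e := e) (fun y => by
      rw [functional_star_mul_self, hπ]; simp)]
  simpa using h2 (star e) x

theorem functional_eq_conj_operator {e : 𝒜} (he : ∀ a ∈ M, e * a = a) (x : 𝒜) :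
    D.functional x = starRingEnd ℂ (D.operator e x) := by
  rw [operator_apply, D.π_left_unit he, inner_conj_symm, functional_apply]

theorem eq_operator
    {hc : ∀ a : M, Continuous fun x : 𝒜 => f ⟨star x * (a : 𝒜), hM _ _ a.2⟩}
    {B : 𝒜 →L[ℂ] Antidual 𝒜}
    (hB : IsKreinVonNeumannExtension (inducedOperator hM f hc) B) : B = D.operator := by
  have hD := D.isKreinVonNeumannExtension_operator hc
  have h : operatorForm B = operatorForm D.operator :=
    sesqForm_ext fun x => le_antisymm (hB.2 _ hD.1 x) (hD.2 _ hB.1 x)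
  ext x y
  exact LinearMap.congr_fun₂ h y x

end IdealGNS

/-! ### Deriving the bound (ii) from (i) and from (iii) -/

section Bounds

variable {𝒜 : Type u} [NonUnitalNormedRing 𝒜] [NormedSpace ℂ 𝒜] [StarRing 𝒜]
  {M : Submodule ℂ 𝒜} (hM : ∀ x a : 𝒜, a ∈ M → x * a ∈ M) {f : M →ₗ[ℂ] ℂ}

theorem IsRepresentableExtension.cyclicBound {g : 𝒜 →L[ℂ] ℂ}
    (hg : IsRepresentableExtension f g) : CyclicBound hM f := by
  obtain ⟨H, _, _, _, π, ζ, h⟩ := hg.representable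
  refine ⟨‖ζ‖ ^ 2, by positivity, fun a => ?_⟩
  have h1 : f ⟨star (a : 𝒜) * a, hM _ _ a.2⟩ = ((‖π a ζ‖ ^ 2 : ℝ) : ℂ) := by
    rw [← hg.extends_f, h, inner_rep_star_mul, inner_self_eq_norm_sq_complex]
  rw [h1, ← hg.extends_f, h, ← Complex.ofReal_mul, Complex.real_le_real, ← mul_pow]
  exact pow_le_pow_left₀ (norm_nonneg _) (norm_inner_le_norm _ _) 2

theorem SupBound.cyclicBound [StarModule ℂ 𝒜] [IsScalarTower ℂ 𝒜 𝒜] {e : 𝒜}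
    (he : ∀ a ∈ M, e * a = a) (hf : SupBound hM f) : CyclicBound hM f := by
  obtain ⟨K, hK, h⟩ := hf
  set r : ℝ := ‖star e‖ + 1 with hr
  have hr0 : 0 < r := by positivity
  refine ⟨r ^ 2 * K, by positivity, fun a => ?_⟩
  -- For this `x` in the unit ball, `x* a = r⁻¹ e a = r⁻¹ a`.
  have h1 := h a (((r⁻¹ : ℝ) : ℂ) • star e) (by
    rw [norm_smul, Complex.norm_real, Real.norm_of_nonneg (by positivity), inv_mul_le_iff₀ hr0]
    linarith)
  have h2 : f ⟨star (((r⁻¹ : ℝ) : ℂ) • star e) * (a : 𝒜), hM _ _ a.2⟩ =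
      ((r⁻¹ : ℝ) : ℂ) * f a := by
    change _ = ((r⁻¹ : ℝ) : ℂ) • f a
    rw [← map_smul]
    congr 1
    ext
    simp [smul_mul_assoc, he a a.2]
  rw [h2, norm_mul, Complex.norm_real, Real.norm_of_nonneg (by positivity)] at h1
  have h3 := mul_le_mul_of_nonneg_left h1
    (Complex.zero_le_real.mpr (sq_nonneg r))
  have h4 : r ^ 2 * (r⁻¹ * ‖f a‖) ^ 2 = ‖f a‖ ^ 2 := by
    field_simp
  rw [← Complex.ofReal_mul, h4, ← mul_assoc, ← Complex.ofReal_mul] at h3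
  exact h3

end Bounds

end KreinExt

theorem corollary5p7 {𝒜 : Type u} [NonUnitalNormedRing 𝒜] [CompleteSpace 𝒜] [NormedSpace ℂ 𝒜]
    [IsScalarTower ℂ 𝒜 𝒜] [SMulCommClass ℂ 𝒜 𝒜] [StarRing 𝒜] [StarModule ℂ 𝒜]
    (M : Submodule ℂ 𝒜) (hM : ∀ x a : 𝒜, a ∈ M → x * a ∈ M)
    (f : M →ₗ[ℂ] ℂ) (e : 𝒜) (he : ∀ a ∈ M, e * a = a) :
    List.TFAE
      [∃ fN : 𝒜 →L[ℂ] ℂ, KreinExt.IsMinimalRepresentableExtension f fN,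
       KreinExt.CyclicBound hM f,
       KreinExt.SupBound hM f] ∧
    (KreinExt.SupBound hM f →
      ∃ hc : ∀ a : M, Continuous fun x : 𝒜 => f ⟨star x * (a : 𝒜), hM _ _ a.2⟩,
        (∃ AN : 𝒜 →L[ℂ] KreinExt.Antidual 𝒜,
          KreinExt.IsKreinVonNeumannExtension (KreinExt.inducedOperator hM f hc) AN) ∧
        ∀ (AN : 𝒜 →L[ℂ] KreinExt.Antidual 𝒜) (fN : 𝒜 →L[ℂ] ℂ),
          KreinExt.IsKreinVonNeumannExtension (KreinExt.inducedOperator hM f hc) AN →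
          KreinExt.IsMinimalRepresentableExtension f fN →
          ∀ x : 𝒜, fN x = starRingEnd ℂ (AN e x)) := by
  have h31 : KreinExt.SupBound hM f → KreinExt.CyclicBound hM f :=
    KreinExt.SupBound.cyclicBound hM he
  refine ⟨?_, fun hf => ?_⟩
  · tfae_have 1 → 2 := fun ⟨_, hg⟩ => hg.1.cyclicBound hM
    tfae_have 2 → 1 := fun hf => by
      obtain ⟨H, _, _, _, ⟨D⟩⟩ := KreinExt.exists_gns hM hf
      exact ⟨D.functional, D.isMinimalRepresentableExtension_functional⟩
    tfae_have 2 → 3 := fun hf => by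
      obtain ⟨H, _, _, _, ⟨D⟩⟩ := KreinExt.exists_gns hM hf
      exact D.supBound
    tfae_have 3 → 2 := h31
    tfae_finish
  · obtain ⟨H, _, _, _, ⟨D⟩⟩ := KreinExt.exists_gns hM (h31 hf)
    refine ⟨D.continuous_apply_star_mul,
      ⟨D.operator, D.isKreinVonNeumannExtension_operator _⟩, fun AN fN hAN hfN x => ?_⟩
    rw [D.eq_functional he hfN, D.eq_operator hAN, D.functional_eq_conj_operator he]
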